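/- Let $L\ge 1$ and let $X_1,\dots,X_L$ be independent, absolutely continuous, almost surely nonnegative real random variables with densities $f_{X_\ell}$. Let $\Psi,\beta,\theta>0$ and let $(\eta_i)_{i\ge 0}$ be real numbers with $\eta_0\neq 0$. Suppose that for every $\ell$ the Laplace transform $\mathscr L\{f_{X_\ell}\}(s)=\int_0^\infty e^{-sx}f_{X_\ell}(x)\,dx$ has the form $$\mathscr L\{f_{X_\ell}\}(s)=\Psi\sum_{i=0}^\infty \eta_i\,s^{-\beta-i\theta}$$ in one of the following two senses: (a) (convergent case) there is $\sigma>0$ such that for all $s\in\mathbb C$ with $\operatorname{Re}s>\sigma$ the series converges absolutely and the equality holds; (b) (divergent case; the series is understood as a Borel sum) there is $\varepsilon>0$ such that $\lim_{i\to\infty}|\eta_i|\,r^i/\Gamma(i\theta+\varepsilon)=0$ for every $r>0$, and, with $B(x)=\sum_{i=0}^\infty \eta_i x^{i\theta+\beta-1}/\Gamma(i\theta+\beta)$ for $x>0$, there is $\sigma>0$ such that for all $s\in\mathbb C$ with $\operatorname{Re}s>\sigma$ the function $e^{-sx}B(x)$ is integrable on $(0,\infty)$ and $\mathscr L\{f_{X_\ell}\}(s)=\Psi\int_0^\infty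 e^{-sx}B(x)\,dx$. Define $$\delta_0=\eta_0^L,\qquad \delta_i=\frac{1}{i\,\eta_0}\sum_{h=1}^{i}\delta_{i-h}\,\eta_h\,(hL+h-i)\quad(i\ge 1).$$ Then $X=\sum_{\ell=1}^L X_\ell$ is absolutely continuous; it has a density $f_X$ vanishing on $(-\infty,0]$ with $$f_X(x)=\Psi^L\sum_{i=0}^\infty\frac{\delta_i\,x^{i\theta+L\beta-1}}{\Gamma(i\theta+L\beta)}\ \ (x>0),$$ and its distribution function satisfies $$F_X(x)=\Psi^L\sum_{i=0}^\infty\frac{\delta_i\,x^{i\theta+L\beta}}{\Gamma(1+i\theta+L\beta)}\ \ (x\ge 0).$$ Both series converge absolutely for all the indicated $x$, and the right-hand side of the first formula is nonnegative for every $x>0$. Moreover, $\sum_{i\ge 0}\delta_i z^i=\bigl(\sum_{i\ge 0}\eta_i z^i\bigr)^L$ as formal power series. -/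

import Mathlib

open MeasureTheory ProbabilityTheory Filter Topology

noncomputable section

namespace LaplaceSum

/-- The (one-sided) Laplace transform `∫₀^∞ e^{-s x} f(x) dx` of a real function, `s ∈ ℂ`. -/
def laplace (f : ℝ → ℝ) (s : ℂ) : ℂ :=
  ∫ x in Set.Ioi (0 : ℝ), Complex.exp (-s * (x : ℂ)) * (f x : ℂ)

/-- A real-valued version of the density of the real random variable `X`. -/
def density {Ω : Type*} [MeasurableSpace Ω] (P : Measure Ω) (X : Ω → ℝ) (x : ℝ) : ℝ :=
  (pdf X P volume x).toReal

/-- The `i`-th term `η_i s^{-β - iθ}` of the series for the Laplace transform. -/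
def laplaceTerm (β θ : ℝ) (η : ℕ → ℝ) (s : ℂ) (i : ℕ) : ℂ :=
  (η i : ℂ) * s ^ (-(β : ℂ) - (i : ℂ) * (θ : ℂ))

/-- Convergent case: on some right half-plane the series `∑ η_i s^{-β - iθ}` converges
absolutely, and `Ψ` times its sum is the Laplace transform of `f`. -/
def HasConvergentForm (f : ℝ → ℝ) (Ψ β θ : ℝ) (η : ℕ → ℝ) : Prop :=
  ∃ σ : ℝ, 0 < σ ∧ ∀ s : ℂ, σ < s.re →
    Summable (fun i => ‖laplaceTerm β θ η s i‖) ∧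
    laplace f s = (Ψ : ℂ) * ∑' i, laplaceTerm β θ η s i

/-- The growth condition `|η_i| r^i / Γ(iθ + ε) → 0` for some `ε > 0` and every `r > 0`: the
coefficients may tend to infinity, but more slowly than `Γ(iθ + ε)`, on the exponential scale. -/
def GrowthCondition (θ : ℝ) (η : ℕ → ℝ) : Prop :=
  ∃ ε : ℝ, 0 < ε ∧ ∀ r : ℝ, 0 < r →
    Tendsto (fun i : ℕ => |η i| * r ^ i / Real.Gamma ((i : ℝ) * θ + ε)) atTop (𝓝 0)

/-- The Borel transform of the formal series `∑ η_i s^{-β - iθ}`, obtained by replacing each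
`s^{-k}` by `x^{k-1} / Γ(k)`, the function whose Laplace transform is `s^{-k}`. -/
def borelTransform (β θ : ℝ) (η : ℕ → ℝ) (x : ℝ) : ℝ :=
  ∑' i : ℕ, η i * x ^ (-1 + θ * (i : ℝ) + β) / Real.Gamma ((i : ℝ) * θ + β)

/-- Divergent case: the series `∑ η_i s^{-β - iθ}` need not converge anywhere; its coefficients
satisfy the growth condition, and the Laplace transform of `f` is `Ψ` times the Borel sum
`∫₀^∞ e^{-s x} (∑ η_i x^{β + iθ - 1} / Γ(β + iθ)) dx` of the series on some right half-plane. -/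
def HasBorelForm (f : ℝ → ℝ) (Ψ β θ : ℝ) (η : ℕ → ℝ) : Prop :=
  GrowthCondition θ η ∧
  ∃ σ : ℝ, 0 < σ ∧ ∀ s : ℂ, σ < s.re →
    IntegrableOn (fun x : ℝ => Complex.exp (-s * (x : ℂ)) * (borelTransform β θ η x : ℂ))
      (Set.Ioi 0) ∧
    laplace f s = (Ψ : ℂ) * laplace (borelTransform β θ η) s

/-- The Laplace transform of `f` has the form `Ψ ∑ η_i s^{-β - iθ}`, the series being either
absolutely convergent or divergent and understood as a Borel sum. -/
def HasLaplaceForm (f : ℝ → ℝ) (Ψ β θ : ℝ) (η : ℕ → ℝ) : Prop :=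
  HasConvergentForm f Ψ β θ η ∨ HasBorelForm f Ψ β θ η

/-- The coefficients `δ_0 = η_0 ^ L`,
`δ_i = (1 / (i η_0)) ∑_{h = 1}^{i} δ_{i-h} η_h (h L + h - i)` for `i ≥ 1`
(below `i = n + 1` and `h = k + 1`; see `delta_recurrence` for the recurrence as displayed). -/
def delta (η : ℕ → ℝ) (L : ℕ) : ℕ → ℝ
  | 0 => η 0 ^ L
  | n + 1 => 1 / (((n : ℝ) + 1) * η 0) * ∑ k : Fin (n + 1),
      delta η L (n - k.val) * η (k.val + 1) *
        (((k.val : ℝ) + 1) * (L : ℝ) + ((k.val : ℝ) + 1) - ((n : ℝ) + 1))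
termination_by n => n

theorem delta_zero (η : ℕ → ℝ) (L : ℕ) : delta η L 0 = η 0 ^ L := by
  rw [delta]

theorem delta_recurrence (η : ℕ → ℝ) (L i : ℕ) (hi : 1 ≤ i) :
    delta η L i = 1 / ((i : ℝ) * η 0) * ∑ h ∈ Finset.Icc 1 i,
      delta η L (i - h) * η h * ((h : ℝ) * (L : ℝ) + (h : ℝ) - (i : ℝ)) := by
  obtain ⟨n, rfl⟩ : ∃ n, i = n + 1 := ⟨i - 1, by omega⟩
  rw [delta, ← Finset.sum_range (fun k => delta η L (n - k) * η (k + 1) *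
        (((k : ℝ) + 1) * (L : ℝ) + ((k : ℝ) + 1) - ((n : ℝ) + 1)))]
  rw [← Finset.Ico_succ_right_eq_Icc, Finset.sum_Ico_eq_sum_range]
  simp only [Nat.cast_add, Nat.cast_one]
  congr 1
  apply Finset.sum_congr (by simp)
  intro k hk
  rw [show n + 1 - (1 + k) = n - k by omega, add_comm 1 k, add_comm (1 : ℝ) (k : ℝ)]

end LaplaceSum

end

namespace LaplaceSum

/-- The recurrence for `delta` is Euler's recurrence for the powers of a power series. -/
theorem mk_delta (η : ℕ → ℝ) (hη : η 0 ≠ 0) (L : ℕ) :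
    PowerSeries.mk (delta η L) = PowerSeries.mk η ^ L := by
  have hode : PowerSeries.mk η * PowerSeries.derivative ℝ (PowerSeries.mk η ^ L) =
      (L : PowerSeries ℝ) * (PowerSeries.derivative ℝ (PowerSeries.mk η) * PowerSeries.mk η ^ L) := by
    rw [Derivation.leibniz_pow]
    rcases L with _ | L
    · simp
    · simp only [Nat.add_sub_cancel, nsmul_eq_mul, smul_eq_mul]
      ring
  have hX := congrArg (fun p => PowerSeries.X * p) hode
  have key : ∀ i, ∑ h ∈ Finset.range (i + 1), η h * (((i - h : ℕ) : ℝ) *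
        PowerSeries.coeff (i - h) (PowerSeries.mk η ^ L)) =
      L * ∑ h ∈ Finset.range (i + 1), (h : ℝ) * η h *
        PowerSeries.coeff (i - h) (PowerSeries.mk η ^ L) := by
    have hXd : ∀ (p : PowerSeries ℝ) (n : ℕ),
        PowerSeries.coeff n (PowerSeries.X * PowerSeries.derivative ℝ p) =
          n * PowerSeries.coeff n p := by
      intro p n
      rcases n with _ | n
      · simp
      · rw [PowerSeries.coeff_succ_X_mul, PowerSeries.coeff_derivative]
        push_cast; ring
    intro i
    have h1 : PowerSeries.mk η *
        (PowerSeries.X * PowerSeries.derivative ℝ (PowerSeries.mk η ^ L)) =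
        PowerSeries.C (L : ℝ) * ((PowerSeries.X * PowerSeries.derivative ℝ (PowerSeries.mk η)) *
          PowerSeries.mk η ^ L) := by
      rw [map_natCast]
      linear_combination hX
    have h2 := congrArg (PowerSeries.coeff i) h1
    rw [PowerSeries.coeff_C_mul, PowerSeries.coeff_mul, PowerSeries.coeff_mul,
      Finset.Nat.sum_antidiagonal_eq_sum_range_succ_mk,
      Finset.Nat.sum_antidiagonal_eq_sum_range_succ_mk] at h2
    simpa only [hXd, PowerSeries.coeff_mk] using h2
  ext i
  rw [PowerSeries.coeff_mk]
  induction i using Nat.strong_induction_on with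
  | _ i ih =>
    rcases Nat.eq_zero_or_pos i with rfl | hi
    · rw [delta_zero, PowerSeries.coeff_zero_eq_constantCoeff_apply, map_pow]
      simp
    · rw [delta_recurrence η L i hi]
      have hi' : (i : ℝ) ≠ 0 := by exact_mod_cast hi.ne'
      rw [div_mul_eq_mul_div, one_mul, div_eq_iff (by positivity)]
      have hk := key i
      rw [Finset.mul_sum, ← sub_eq_zero, ← Finset.sum_sub_distrib,
        Finset.sum_range_succ'] at hk
      rw [← Finset.Ico_succ_right_eq_Icc, Finset.sum_Ico_eq_sum_range]
      simp only [Nat.sub_zero, Nat.cast_zero, zero_mul, mul_zero, sub_zero] at hk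
      have : ∑ k ∈ Finset.range (Order.succ i - 1), delta η L (i - (1 + k)) * η (1 + k) *
          (((1 + k : ℕ) : ℝ) * L + ((1 + k : ℕ) : ℝ) - i) =
          - ∑ x ∈ Finset.range i, (η (x + 1) * (((i - (x + 1) : ℕ) : ℝ) *
              PowerSeries.coeff (i - (x + 1)) (PowerSeries.mk η ^ L)) -
            L * (((x + 1 : ℕ) : ℝ) * η (x + 1) *
              PowerSeries.coeff (i - (x + 1)) (PowerSeries.mk η ^ L))) := by
        rw [← Finset.sum_neg_distrib]
        refine Finset.sum_congr (by simp) fun k hk => ?_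
        have hki : k + 1 ≤ i := by simpa using hk
        rw [add_comm 1 k, ih _ (by omega), Nat.cast_sub hki]
        ring
      rw [this]
      linarith

theorem integrable_exp_mul_withDensity_ofReal {μ : Measure ℝ} {k : ℝ → ℝ} {t : ℝ}
    (hk : Integrable k μ) (ht : Integrable (fun x => Real.exp (t * x) * k x) μ) :
    Integrable (fun x => Real.exp (t * x)) (μ.withDensity fun x => ENNReal.ofReal (k x)) := by
  rw [integrable_withDensity_iff_integrable_smul₀' hk.1.aemeasurable.ennreal_ofReal
    (by simp)]
  refine ht.mono ?_ (ae_of_all _ fun x => ?_)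
  · exact (hk.1.aemeasurable.ennreal_ofReal.ennreal_toReal.smul
      (by fun_prop)).aestronglyMeasurable
  · rw [smul_eq_mul, norm_mul, norm_mul, mul_comm]
    gcongr
    rw [Real.norm_of_nonneg ENNReal.toReal_nonneg, ENNReal.toReal_ofReal']
    exact max_le (le_abs_self _) (abs_nonneg _)

/-- A function on the half-line whose Laplace transform converges absolutely and vanishes
on a real half-line is zero almost everywhere. -/
theorem ae_eq_zero_of_laplace_eq_zero {h : ℝ → ℝ} {σ : ℝ}
    (hint : ∀ s, σ < s → IntegrableOn (fun x => Real.exp (-s * x) * h x) (Set.Ioi 0))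
    (hzero : ∀ s, σ < s → ∫ x in Set.Ioi 0, Real.exp (-s * x) * h x = 0) :
    h =ᵐ[volume.restrict (Set.Ioi 0)] 0 := by
  set μ := volume.restrict (Set.Ioi (0 : ℝ)) with hμ
  set k : ℝ → ℝ := fun x => Real.exp (-(σ + 1) * x) * h x with hk_def
  have hk : Integrable k μ := hint _ (by linarith)
  have hexp : ∀ t x : ℝ, Real.exp (t * x) * k x = Real.exp (-(σ + 1 - t) * x) * h x := by
    intro t x
    rw [hk_def, ← mul_assoc, ← Real.exp_add]
    ring_nf
  have hkt : ∀ t < 1, Integrable (fun x => Real.exp (t * x) * k x) μ := by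
    intro t ht
    simp only [hexp]
    exact hint _ (by linarith)
  have hkt' : ∀ t < 1, Integrable (fun x => Real.exp (t * x) * (-k) x) μ := by
    intro t ht
    simp only [Pi.neg_apply, mul_neg]
    exact (hkt t ht).neg
  have hk0 : ∀ t < 1, ∫ x, Real.exp (t * x) * k x ∂μ = 0 := by
    intro t ht
    simp only [hexp]
    exact hzero _ (by linarith)
  set μp := μ.withDensity fun x => ENNReal.ofReal (k x) with hμp
  set μm := μ.withDensity fun x => ENNReal.ofReal ((-k) x) with hμm
  have : IsFiniteMeasure μp := isFiniteMeasure_withDensity_ofReal hk.2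
  have : IsFiniteMeasure μm := isFiniteMeasure_withDensity_ofReal hk.neg.2
  have hmgf : ∀ t < 1, mgf id μp t = mgf id μm t := by
    intro t ht
    have hp := integrable_exp_mul_withDensity_ofReal hk (hkt t ht)
    have hm := integrable_exp_mul_withDensity_ofReal hk.neg (hkt' t ht)
    rw [integrable_withDensity_iff_integrable_smul₀' hk.1.aemeasurable.ennreal_ofReal
      (by simp)] at hp
    rw [integrable_withDensity_iff_integrable_smul₀' hk.neg.1.aemeasurable.ennreal_ofReal
      (by simp)] at hm
    simp only [mgf, id]
    rw [integral_withDensity_eq_integral_toReal_smul₀ hk.1.aemeasurable.ennreal_ofReal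
        (by simp), integral_withDensity_eq_integral_toReal_smul₀
        hk.neg.1.aemeasurable.ennreal_ofReal (by simp), ← sub_eq_zero, ← integral_sub hp hm,
      ← hk0 t ht]
    congr with x
    simp only [ENNReal.toReal_ofReal', smul_eq_mul, Pi.neg_apply]
    rw [← sub_mul, mul_comm]
    rcases le_total (k x) 0 with h | h
    · rw [max_eq_right h, max_eq_left (by linarith)]; ring
    · rw [max_eq_left h, max_eq_right (by linarith)]; ring
  have hsubp : Set.Iio (1 : ℝ) ⊆ interior (integrableExpSet id μp) :=
    isOpen_Iio.subset_interior_iff.2 fun t ht =>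
      integrable_exp_mul_withDensity_ofReal hk (hkt t ht)
  have hsubm : Set.Iio (1 : ℝ) ⊆ interior (integrableExpSet id μm) :=
    isOpen_Iio.subset_interior_iff.2 fun t ht =>
      integrable_exp_mul_withDensity_ofReal hk.neg (hkt' t ht)
  have heq : Set.EqOn (complexMGF id μp) (complexMGF id μm) {z | z.re < 1} := by
    refine AnalyticOnNhd.eqOn_of_preconnected_of_frequently_eq (z₀ := 0)
      (analyticOnNhd_complexMGF.mono fun z hz => hsubp hz)
      (analyticOnNhd_complexMGF.mono fun z hz => hsubm hz)
      (convex_halfSpace_re_lt 1).isPreconnected (by simp) ?_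
    have h_real : ∃ᶠ x : ℝ in 𝓝[≠] (0 : ℝ), complexMGF id μp x = complexMGF id μm x := by
      refine Eventually.frequently ?_
      filter_upwards [nhdsWithin_le_nhds (Iio_mem_nhds (zero_lt_one' ℝ))] with x hx
      rw [complexMGF_ofReal, complexMGF_ofReal, hmgf x hx]
    have htend : Tendsto (fun x : ℝ => (x : ℂ)) (𝓝[≠] 0) (𝓝[≠] 0) := by
      refine tendsto_nhdsWithin_iff.2 ⟨?_, ?_⟩
      · exact (Complex.continuous_ofReal.tendsto' 0 0 Complex.ofReal_zero).mono_left
          nhdsWithin_le_nhds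
      · filter_upwards [self_mem_nhdsWithin] with x hx
        simpa using hx
    exact htend.frequently h_real
  have hmeas : μp = μm := by
    refine Measure.ext_of_charFun (funext fun t => ?_)
    rw [← complexMGF_id_mul_I, ← complexMGF_id_mul_I]
    exact heq (by simp)
  rw [hμp, hμm, withDensity_eq_iff hk.1.aemeasurable.ennreal_ofReal
    hk.neg.1.aemeasurable.ennreal_ofReal hk.lintegral_lt_top.ne] at hmeas
  filter_upwards [hmeas] with x hx
  have hkx : k x = 0 := by
    have h2 := congrArg ENNReal.toReal hx
    simp only [ENNReal.toReal_ofReal', Pi.neg_apply] at h2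
    rcases le_total (k x) 0 with h | h
    · rw [max_eq_right h, max_eq_left (by linarith)] at h2; linarith
    · rw [max_eq_left h, max_eq_right (by linarith)] at h2; linarith
  simpa [hk_def, Real.exp_ne_zero] using hkx

theorem integrable_tsum_of_summable_integral_norm {α E ι : Type*} [MeasurableSpace α]
    {μ : Measure α} [NormedAddCommGroup E] [CompleteSpace E] [Countable ι] {F : ι → α → E}
    (hF : ∀ i, Integrable (F i) μ) (hsum : Summable fun i => ∫ a, ‖F i a‖ ∂μ)
    (hpt : ∀ᵐ a ∂μ, Summable fun i => ‖F i a‖) :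
    Integrable (fun a => ∑' i, F i a) μ := by
  constructor
  · refine aestronglyMeasurable_of_tendsto_ae (u := atTop)
      (f := fun (s : Finset ι) a => ∑ i ∈ s, F i a) (fun s => ?_) ?_
    · exact (integrable_finsetSum s fun i _ => hF i).1
    · filter_upwards [hpt] with a ha
      exact ha.of_norm.hasSum
  · refine lt_of_le_of_lt (lintegral_mono fun a => enorm_tsum_le_tsum_enorm) ?_
    rw [lintegral_tsum fun i => (hF i).1.enorm]
    simp_rw [← ofReal_integral_norm_eq_lintegral_enorm (hF _)]
    exact hsum.tsum_ofReal_lt_top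

/-- A lower bound showing that `Γ` outgrows every exponential. -/
theorem rpow_mul_exp_neg_le_Gamma {T y : ℝ} (hT : 0 < T) (hy : 1 ≤ y) :
    T ^ (y - 1) * Real.exp (-T) ≤ Real.Gamma y := by
  have hint := Real.GammaIntegral_convergent (s := y) (by linarith)
  rw [Real.Gamma_eq_integral (by linarith), ← integral_exp_neg_Ioi, ← integral_const_mul]
  have hsub : Set.Ioi T ⊆ Set.Ioi 0 := Set.Ioi_subset_Ioi hT.le
  calc ∫ x in Set.Ioi T, T ^ (y - 1) * Real.exp (-x)
      ≤ ∫ x in Set.Ioi T, Real.exp (-x) * x ^ (y - 1) := by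
        refine setIntegral_mono_on ((integrableOn_exp_neg_Ioi T).const_mul _)
          (hint.mono_set hsub) measurableSet_Ioi fun x hx => ?_
        rw [mul_comm]
        have : T ≤ x := le_of_lt hx
        gcongr
    _ ≤ _ := by
        refine setIntegral_mono_set hint ?_ hsub.eventuallyLE
        filter_upwards [ae_restrict_mem measurableSet_Ioi] with x hx
        have : 0 < x := hx
        simp only [Pi.zero_apply]
        positivity

/-- Shifting the argument of `Γ` costs at most a polynomial factor. -/
theorem Gamma_add_nat_le {y : ℝ} (hy : 0 < y) (n : ℕ) :
    Real.Gamma (y + n) ≤ Real.Gamma y * (y + n) ^ n := by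
  induction n with
  | zero => simp
  | succ n ih =>
    have h0 : 0 < y + n := by positivity
    have hG := Real.Gamma_pos_of_pos hy
    rw [Nat.cast_succ, ← add_assoc, Real.Gamma_add_one h0.ne', pow_succ', mul_left_comm]
    have h1 : y + n ≤ y + n + 1 := by linarith
    calc (y + n) * Real.Gamma (y + n) ≤ (y + n) * (Real.Gamma y * (y + n) ^ n) := by gcongr
      _ ≤ (y + n + 1) * (Real.Gamma y * (y + n + 1) ^ n) := by gcongr

/-- Absolute convergence on `(0, ∞)` of the series defining `borelTransform α θ a`. -/
def BorelSummable (α θ : ℝ) (a : ℕ → ℝ) : Prop :=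
  ∀ x : ℝ, 0 < x → Summable fun i : ℕ =>
    |a i * x ^ (-1 + θ * (i : ℝ) + α) / Real.Gamma ((i : ℝ) * θ + α)|

theorem GrowthCondition.borelSummable {α θ : ℝ} {a : ℕ → ℝ} (hα : 0 < α) (hθ : 0 < θ)
    (h : GrowthCondition θ a) : BorelSummable α θ a := by
  intro x hx
  obtain ⟨ε, hε, hlim⟩ := h
  obtain ⟨n, hn⟩ := exists_nat_ge (ε - α)
  have hxθ : 0 < x ^ θ := Real.rpow_pos_of_pos hx θ
  have hbd := (hlim (2 * x ^ θ) (by positivity)).eventually_le_const zero_lt_one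
  have hlarge : ∀ᶠ i : ℕ in atTop, 2 ≤ (i : ℝ) * θ + ε :=
    (tendsto_atTop_add_const_right _ ε
      (tendsto_natCast_atTop_atTop.atTop_mul_const hθ)).eventually_ge_atTop 2
  refine summable_of_isBigO_nat (g := fun i : ℕ => (i : ℝ) ^ n * (1 / 2 : ℝ) ^ i)
    (summable_pow_mul_geometric_of_norm_lt_one n (by norm_num)) ?_
  refine Asymptotics.IsBigO.of_bound (x ^ (α - 1) * (θ + α + n) ^ n) ?_
  filter_upwards [hbd, hlarge, eventually_ge_atTop 1] with i hi1 hi2 hi3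
  have hi3' : (1 : ℝ) ≤ i := by exact_mod_cast hi3
  have hΓα : 0 < Real.Gamma (i * θ + α) := Real.Gamma_pos_of_pos (by positivity)
  have hΓε : 0 < Real.Gamma (i * θ + ε) := Real.Gamma_pos_of_pos (by positivity)
  have hΓ : Real.Gamma (i * θ + ε) ≤ Real.Gamma (i * θ + α) * (i ^ n * (θ + α + n) ^ n) := by
    calc Real.Gamma (i * θ + ε) ≤ Real.Gamma (i * θ + α + n) :=
          Real.Gamma_strictMonoOn_Ici.monotoneOn hi2
            (by simp only [Set.mem_Ici]; linarith) (by linarith)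
      _ ≤ Real.Gamma (i * θ + α) * (i * θ + α + n) ^ n := Gamma_add_nat_le (by positivity) n
      _ ≤ _ := by
        rw [← mul_pow]
        gcongr
        nlinarith [mul_nonneg (sub_nonneg.2 hi3') (add_nonneg hα.le (Nat.cast_nonneg (α := ℝ) n))]
  have hpow : x ^ (-1 + θ * (i : ℝ) + α) = x ^ (α - 1) * (2 * x ^ θ) ^ i * (1 / 2 : ℝ) ^ i := by
    rw [mul_assoc, ← mul_pow, show 2 * x ^ θ * (1 / 2) = x ^ θ by ring, ← Real.rpow_natCast,
      ← Real.rpow_mul hx.le, ← Real.rpow_add hx]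
    ring_nf
  have hxα : 0 < x ^ (α - 1) := Real.rpow_pos_of_pos hx _
  rw [div_le_one hΓε] at hi1
  rw [Real.norm_eq_abs, abs_abs, abs_div, abs_mul, abs_of_pos hΓα, hpow,
    abs_of_pos (by positivity : 0 < x ^ (α - 1) * (2 * x ^ θ) ^ i * (1 / 2 : ℝ) ^ i),
    Real.norm_of_nonneg (by positivity), div_le_iff₀ hΓα]
  calc |a i| * (x ^ (α - 1) * (2 * x ^ θ) ^ i * (1 / 2) ^ i)
      = x ^ (α - 1) * (1 / 2) ^ i * (|a i| * (2 * x ^ θ) ^ i) := by ring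
    _ ≤ x ^ (α - 1) * (1 / 2) ^ i * (Real.Gamma (i * θ + α) * (i ^ n * (θ + α + n) ^ n)) := by
      exact mul_le_mul_of_nonneg_left (hi1.trans hΓ) (by positivity)
    _ = _ := by ring

/-- Geometrically bounded coefficients satisfy the growth condition. -/
theorem growthCondition_of_le_geometric {θ C R : ℝ} {a : ℕ → ℝ} (hθ : 0 < θ) (hR : 0 < R)
    (h : ∀ i, |a i| ≤ C * R ^ i) : GrowthCondition θ a := by
  refine ⟨1, one_pos, fun r hr => ?_⟩
  set T : ℝ := (2 * R * r) ^ θ⁻¹ with hT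
  have hTpos : 0 < T := by positivity
  have hTθ : T ^ θ = 2 * R * r := by
    rw [hT, ← Real.rpow_mul (by positivity), inv_mul_cancel₀ hθ.ne', Real.rpow_one]
  have hC : 0 ≤ C := by simpa using (abs_nonneg _).trans (h 0)
  refine squeeze_zero (g := fun i : ℕ => C * Real.exp T * (1 / 2 : ℝ) ^ i)
    (fun i => div_nonneg (by positivity) (Real.Gamma_pos_of_pos (by positivity)).le) (fun i => ?_) ?_
  · have hΓ := rpow_mul_exp_neg_le_Gamma hTpos (y := i * θ + 1) (by
      have : (0 : ℝ) ≤ i * θ := by positivity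
      linarith)
    have h1 : T ^ ((i : ℝ) * θ + 1 - 1) = (2 * R * r) ^ i := by
      rw [add_sub_cancel_right, mul_comm, Real.rpow_mul hTpos.le, hTθ, Real.rpow_natCast]
    rw [h1] at hΓ
    rw [div_le_iff₀ (Real.Gamma_pos_of_pos (by positivity))]
    calc |a i| * r ^ i ≤ C * R ^ i * r ^ i := by gcongr; exact h i
      _ = C * Real.exp T * (1 / 2) ^ i * ((2 * R * r) ^ i * Real.exp (-T)) := by
        rw [Real.exp_neg, mul_pow, mul_pow]
        have : (1 / 2 : ℝ) ^ i * 2 ^ i = 1 := by rw [← mul_pow]; norm_num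
        field_simp
        linear_combination (-C) * this
      _ ≤ _ := by gcongr
  · simpa using (tendsto_pow_atTop_nhds_zero_of_lt_one (by norm_num : (0 : ℝ) ≤ 1 / 2)
      (by norm_num)).const_mul (C * Real.exp T)

theorem continuousOn_borelTransform {α θ : ℝ} {a : ℕ → ℝ} (hα : 0 < α) (hθ : 0 < θ)
    (h : BorelSummable α θ a) : ContinuousOn (borelTransform α θ a) (Set.Ioi 0) := by
  have hfac : Set.EqOn (borelTransform α θ a) (fun x => x ^ (α - 1) *
      ∑' i : ℕ, a i * x ^ (θ * (i : ℝ)) / Real.Gamma ((i : ℝ) * θ + α)) (Set.Ioi 0) := by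
    intro x hx
    have hx : 0 < x := hx
    simp only [borelTransform, ← tsum_mul_left]
    refine tsum_congr fun i => ?_
    rw [show -1 + θ * (i : ℝ) + α = (α - 1) + θ * i by ring, Real.rpow_add hx]
    ring
  refine ContinuousOn.congr ?_ hfac
  refine ContinuousOn.mul (fun x hx => (Real.continuousAt_rpow_const _ _
    (Or.inl (ne_of_gt hx))).continuousWithinAt) ?_
  intro x hx
  have hx : 0 < x := hx
  have hxy : x < x + 1 := by linarith
  have hs := (h (x + 1) (by linarith)).mul_left ((x + 1) ^ (-(α - 1)))
  have hcont : ContinuousOn (fun x : ℝ => ∑' i : ℕ, a i * x ^ (θ * (i : ℝ)) /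
      Real.Gamma ((i : ℝ) * θ + α)) (Set.Ioo 0 (x + 1)) := by
    refine continuousOn_tsum (fun i => ?_) hs fun i y hy => ?_
    · exact ((continuousOn_id.rpow_const fun y hy => Or.inr (by positivity)).const_mul _
        |>.div_const _)
    · have hΓ : 0 < Real.Gamma (i * θ + α) := Real.Gamma_pos_of_pos (by positivity)
      have hx1 : 0 < x + 1 := by linarith
      have hy0 := hy.1
      rw [show -1 + θ * (i : ℝ) + α = (α - 1) + θ * i by ring, Real.rpow_add hx1, Real.norm_eq_abs,
        abs_div, abs_div, abs_mul, abs_mul, abs_mul, abs_of_pos hΓ,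
        abs_of_pos (Real.rpow_pos_of_pos hy0 _), abs_of_pos (Real.rpow_pos_of_pos hx1 _),
        abs_of_pos (Real.rpow_pos_of_pos hx1 _), Real.rpow_neg hx1.le]
      have h1 : y ^ (θ * (i : ℝ)) ≤ (x + 1) ^ (θ * (i : ℝ)) :=
        Real.rpow_le_rpow hy0.le hy.2.le (by positivity)
      have h2 : 0 < (x + 1) ^ (α - 1) := Real.rpow_pos_of_pos hx1 _
      calc |a i| * y ^ (θ * (i : ℝ)) / Real.Gamma (i * θ + α)
          ≤ |a i| * (x + 1) ^ (θ * (i : ℝ)) / Real.Gamma (i * θ + α) := by gcongr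
        _ = _ := by field_simp
  exact (hcont.continuousAt (Ioo_mem_nhds hx hxy)).continuousWithinAt

theorem integral_rpow_mul_sub_rpow {p q x : ℝ} (hp : 0 < p) (hq : 0 < q) (hx : 0 < x) :
    ∫ y in Set.Ioo 0 x, y ^ (p - 1) * (x - y) ^ (q - 1) =
      x ^ (p + q - 1) * (Real.Gamma p * Real.Gamma q / Real.Gamma (p + q)) := by
  have h := Complex.betaIntegral_scaled p q hx
  rw [Complex.betaIntegral_eq_Gamma_mul_div _ _ (by simpa) (by simpa),
    intervalIntegral.integral_of_le hx.le, integral_Ioc_eq_integral_Ioo] at h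
  rw [← Complex.ofReal_inj, ← integral_complex_ofReal]
  refine Eq.trans ?_ (h.trans ?_)
  · refine setIntegral_congr_fun measurableSet_Ioo fun y hy => ?_
    have h1 : 0 ≤ y := hy.1.le
    have h2 : 0 ≤ x - y := sub_nonneg.2 hy.2.le
    push_cast [Complex.ofReal_cpow h1, Complex.ofReal_cpow h2]
    rfl
  · push_cast [Complex.ofReal_cpow hx.le, ← Complex.Gamma_ofReal]
    rfl

theorem integrableOn_rpow_mul_sub_rpow {p q x : ℝ} (hp : 0 < p) (hq : 0 < q) (hx : 0 < x) :
    IntegrableOn (fun y => y ^ (p - 1) * (x - y) ^ (q - 1)) (Set.Ioo 0 x) := by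
  have hΓ : 0 < Real.Gamma p * Real.Gamma q / Real.Gamma (p + q) :=
    div_pos (mul_pos (Real.Gamma_pos_of_pos hp) (Real.Gamma_pos_of_pos hq))
      (Real.Gamma_pos_of_pos (by positivity))
  refine Integrable.of_integral_ne_zero ?_
  rw [integral_rpow_mul_sub_rpow hp hq hx]
  positivity

theorem Gamma_mul_Gamma_div_antitone {p q p' q' : ℝ} (hp : 0 < p) (hq : 0 < q) (hpp : p ≤ p')
    (hqq : q ≤ q') : Real.Gamma p' * Real.Gamma q' / Real.Gamma (p' + q') ≤
      Real.Gamma p * Real.Gamma q / Real.Gamma (p + q) := by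
  have hp' := hp.trans_le hpp
  have hq' := hq.trans_le hqq
  have h := integral_rpow_mul_sub_rpow hp hq one_pos
  have h' := integral_rpow_mul_sub_rpow hp' hq' one_pos
  rw [Real.one_rpow, one_mul] at h h'
  rw [← h, ← h']
  refine setIntegral_mono_on (integrableOn_rpow_mul_sub_rpow hp' hq' one_pos)
    (integrableOn_rpow_mul_sub_rpow hp hq one_pos) measurableSet_Ioo fun y hy => ?_
  have h1 : 0 < 1 - y := sub_pos.2 hy.2
  have h2 : y ^ (p' - 1) ≤ y ^ (p - 1) :=
    Real.rpow_le_rpow_of_exponent_ge hy.1 hy.2.le (by linarith)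
  have h3 : (1 - y) ^ (q' - 1) ≤ (1 - y) ^ (q - 1) :=
    Real.rpow_le_rpow_of_exponent_ge h1 (by linarith [hy.1]) (by linarith)
  have := hy.1
  gcongr

/-- The function with Laplace transform `s ^ (-p)`. -/
noncomputable def gammaKernel (p x : ℝ) : ℝ := x ^ (p - 1) / Real.Gamma p

theorem borelTransform_term (α θ : ℝ) (a : ℕ → ℝ) (x : ℝ) (i : ℕ) :
    a i * x ^ (-1 + θ * (i : ℝ) + α) / Real.Gamma ((i : ℝ) * θ + α) =
      a i * gammaKernel (i * θ + α) x := by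
  rw [gammaKernel, mul_div_assoc]
  ring_nf

theorem borelTransform_eq (α θ : ℝ) (a : ℕ → ℝ) (x : ℝ) :
    borelTransform α θ a x = ∑' i : ℕ, a i * gammaKernel (i * θ + α) x := by
  simp only [borelTransform, borelTransform_term]

theorem borelSummable_iff {α θ : ℝ} {a : ℕ → ℝ} :
    BorelSummable α θ a ↔
      ∀ x : ℝ, 0 < x → Summable fun i : ℕ => ‖a i * gammaKernel (i * θ + α) x‖ := by
  simp only [BorelSummable, borelTransform_term, Real.norm_eq_abs]

theorem gammaKernel_nonneg {p x : ℝ} (hp : 0 < p) (hx : 0 ≤ x) : 0 ≤ gammaKernel p x :=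
  div_nonneg (Real.rpow_nonneg hx _) (Real.Gamma_pos_of_pos hp).le

theorem integrableOn_gammaKernel_mul {p q x : ℝ} (hp : 0 < p) (hq : 0 < q) (hx : 0 < x) :
    IntegrableOn (fun y => gammaKernel p y * gammaKernel q (x - y)) (Set.Ioo 0 x) := by
  refine ((integrableOn_rpow_mul_sub_rpow hp hq hx).mul_const
    (Real.Gamma p * Real.Gamma q)⁻¹).congr (ae_of_all _ fun y => ?_)
  simp only [gammaKernel]
  rw [mul_inv]
  ring

theorem integral_gammaKernel_mul {p q x : ℝ} (hp : 0 < p) (hq : 0 < q) (hx : 0 < x) :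
    ∫ y in Set.Ioo 0 x, gammaKernel p y * gammaKernel q (x - y) = gammaKernel (p + q) x := by
  have hΓp := Real.Gamma_pos_of_pos hp
  have hΓq := Real.Gamma_pos_of_pos hq
  calc _ = ∫ y in Set.Ioo 0 x,
        y ^ (p - 1) * (x - y) ^ (q - 1) * (Real.Gamma p * Real.Gamma q)⁻¹ := by
        congr with y
        simp only [gammaKernel]
        rw [mul_inv]
        ring
    _ = _ := by
        rw [integral_mul_const, integral_rpow_mul_sub_rpow hp hq hx, gammaKernel]
        field_simp

theorem gammaKernel_add_le {p q p' q' x : ℝ} (hp : 0 < p) (hq : 0 < q) (hpp : p ≤ p')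
    (hqq : q ≤ q') (hx : 0 < x) : gammaKernel (p' + q') x ≤
      x * (Real.Gamma p * Real.Gamma q / Real.Gamma (p + q)) *
        (gammaKernel p' x * gammaKernel q' x) := by
  have h := Gamma_mul_Gamma_div_antitone hp hq hpp hqq
  have h1 := Real.Gamma_pos_of_pos (hp.trans_le hpp)
  have h2 := Real.Gamma_pos_of_pos (hq.trans_le hqq)
  have hk := mul_nonneg (gammaKernel_nonneg (hp.trans_le hpp) hx.le)
    (gammaKernel_nonneg (hq.trans_le hqq) hx.le)
  calc gammaKernel (p' + q') x = x * (Real.Gamma p' * Real.Gamma q' / Real.Gamma (p' + q')) *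
        (gammaKernel p' x * gammaKernel q' x) := by
        simp only [gammaKernel]
        rw [show p' + q' - 1 = 1 + (p' - 1) + (q' - 1) by ring, Real.rpow_add hx,
          Real.rpow_add hx, Real.rpow_one]
        field_simp
    _ ≤ _ := by gcongr

section Convolution

variable {α β θ : ℝ} {a b : ℕ → ℝ}

theorem summable_convolution_terms (hα : 0 < α) (hβ : 0 < β) (hθ : 0 < θ)
    (ha : BorelSummable α θ a) (hb : BorelSummable β θ b) {x : ℝ} (hx : 0 < x) :
    Summable fun z : ℕ × ℕ =>
      |a z.1 * b z.2| * gammaKernel ((z.1 * θ + α) + (z.2 * θ + β)) x := by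
  have hs := (summable_mul_of_summable_norm (borelSummable_iff.1 ha x hx).norm
    (borelSummable_iff.1 hb x hx).norm).mul_left
    (x * (Real.Gamma α * Real.Gamma β / Real.Gamma (α + β)))
  refine Summable.of_nonneg_of_le (fun z => ?_) (fun z => ?_) hs
  · exact mul_nonneg (abs_nonneg _) (gammaKernel_nonneg (by positivity) hx.le)
  · have h1 : (0 : ℝ) ≤ z.1 * θ := by positivity
    have h2 : (0 : ℝ) ≤ z.2 * θ := by positivity
    have h := gammaKernel_add_le hα hβ (p' := z.1 * θ + α) (q' := z.2 * θ + β)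
      (by linarith) (by linarith) hx
    rw [norm_mul, norm_mul, Real.norm_of_nonneg (gammaKernel_nonneg (by positivity) hx.le),
      Real.norm_of_nonneg (gammaKernel_nonneg (by positivity) hx.le), abs_mul]
    calc _ ≤ |a z.1| * |b z.2| * _ := mul_le_mul_of_nonneg_left h (by positivity)
      _ = _ := by simp only [Real.norm_eq_abs]; ring

theorem coeff_mk_mul_mk_mul_gammaKernel (a b : ℕ → ℝ) (α β θ x : ℝ) (n : ℕ) :
    PowerSeries.coeff n (PowerSeries.mk a * PowerSeries.mk b) *
        gammaKernel (n * θ + (α + β)) x =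
      ∑ z ∈ Finset.HasAntidiagonal.antidiagonal n,
        a z.1 * b z.2 * gammaKernel ((z.1 * θ + α) + (z.2 * θ + β)) x := by
  rw [PowerSeries.coeff_mul, Finset.sum_mul]
  refine Finset.sum_congr rfl fun z hz => ?_
  rw [PowerSeries.coeff_mk, PowerSeries.coeff_mk, ← Finset.HasAntidiagonal.mem_antidiagonal.1 hz]
  push_cast
  ring_nf

/-- The Cauchy product of coefficient sequences preserves convergence of Borel transforms. -/
theorem BorelSummable.mul (hα : 0 < α) (hβ : 0 < β) (hθ : 0 < θ)
    (ha : BorelSummable α θ a) (hb : BorelSummable β θ b) :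
    BorelSummable (α + β) θ
      fun n => PowerSeries.coeff n (PowerSeries.mk a * PowerSeries.mk b) := by
  rw [borelSummable_iff]
  intro x hx
  have hs := summable_convolution_terms hα hβ hθ ha hb hx
  rw [← (Finset.HasAntidiagonal.sigmaAntidiagonalEquivProd (A := ℕ)).summable_iff] at hs
  refine Summable.of_nonneg_of_le (fun n => norm_nonneg _) (fun n => ?_) hs.sigma
  rw [coeff_mk_mul_mk_mul_gammaKernel, tsum_fintype, Finset.univ_eq_attach]
  refine (norm_sum_le _ _).trans ?_
  rw [← Finset.sum_attach]
  refine Finset.sum_le_sum fun z _ => ?_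
  rw [norm_mul, Real.norm_eq_abs,
    Real.norm_of_nonneg (gammaKernel_nonneg (by positivity) hx.le)]
  simp

/-- The convolution of two Borel transforms is the Borel transform of the product series. -/
theorem integral_borelTransform_mul_borelTransform (hα : 0 < α) (hβ : 0 < β) (hθ : 0 < θ)
    (ha : BorelSummable α θ a) (hb : BorelSummable β θ b) {x : ℝ} (hx : 0 < x) :
    IntegrableOn (fun y => borelTransform α θ a y * borelTransform β θ b (x - y)) (Set.Ioo 0 x) ∧
      ∫ y in Set.Ioo 0 x, borelTransform α θ a y * borelTransform β θ b (x - y) =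
        borelTransform (α + β) θ
          (fun n => PowerSeries.coeff n (PowerSeries.mk a * PowerSeries.mk b)) x := by
  set F : ℕ × ℕ → ℝ → ℝ := fun z y =>
    (a z.1 * gammaKernel (z.1 * θ + α) y) * (b z.2 * gammaKernel (z.2 * θ + β) (x - y)) with hF
  have hFeq : ∀ z y, F z y = a z.1 * b z.2 *
      (gammaKernel (z.1 * θ + α) y * gammaKernel (z.2 * θ + β) (x - y)) := by
    intro z y
    simp only [hF]; ring
  have hFint : ∀ z, IntegrableOn (F z) (Set.Ioo 0 x) := by
    intro z
    simp only [funext (hFeq z)]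
    exact (integrableOn_gammaKernel_mul (by positivity) (by positivity) hx).const_mul _
  have hFval : ∀ z, ∫ y in Set.Ioo 0 x, F z y =
      a z.1 * b z.2 * gammaKernel ((z.1 * θ + α) + (z.2 * θ + β)) x := by
    intro z
    simp only [hFeq]
    rw [integral_const_mul, integral_gammaKernel_mul (by positivity) (by positivity) hx]
  have hFnorm : ∀ z, ∫ y in Set.Ioo 0 x, ‖F z y‖ =
      |a z.1 * b z.2| * gammaKernel ((z.1 * θ + α) + (z.2 * θ + β)) x := by
    intro z
    rw [← integral_gammaKernel_mul (by positivity) (by positivity) hx, ← integral_const_mul]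
    refine setIntegral_congr_fun measurableSet_Ioo fun y hy => ?_
    simp only [hFeq]
    rw [norm_mul, Real.norm_eq_abs, Real.norm_of_nonneg (mul_nonneg
      (gammaKernel_nonneg (by positivity) hy.1.le)
      (gammaKernel_nonneg (by positivity) (sub_nonneg.2 hy.2.le)))]
  have hsum := summable_convolution_terms hα hβ hθ ha hb hx
  have hFsum : Summable fun z => ∫ y in Set.Ioo 0 x, ‖F z y‖ := by simpa only [hFnorm] using hsum
  have hpt : ∀ y ∈ Set.Ioo 0 x, (Summable fun z => ‖F z y‖) ∧
      ∑' z, F z y = borelTransform α θ a y * borelTransform β θ b (x - y) := by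
    intro y hy
    have h1 := borelSummable_iff.1 ha y hy.1
    have h2 := borelSummable_iff.1 hb (x - y) (sub_pos.2 hy.2)
    rw [borelTransform_eq, borelTransform_eq, tsum_mul_tsum_of_summable_norm h1 h2]
    exact ⟨(summable_mul_of_summable_norm h1 h2).norm, rfl⟩
  have hcongr : (fun y => ∑' z, F z y) =ᵐ[volume.restrict (Set.Ioo 0 x)]
      fun y => borelTransform α θ a y * borelTransform β θ b (x - y) := by
    filter_upwards [ae_restrict_mem measurableSet_Ioo] with y hy using (hpt y hy).2
  constructor
  · refine (integrable_tsum_of_summable_integral_norm hFint hFsum ?_).congr hcongr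
    filter_upwards [ae_restrict_mem measurableSet_Ioo] with y hy using (hpt y hy).1
  · have h := hasSum_integral_of_summable_integral_norm hFint hFsum
    rw [integral_congr_ae hcongr] at h
    simp only [hFval] at h
    rw [← (Finset.HasAntidiagonal.sigmaAntidiagonalEquivProd (A := ℕ)).hasSum_iff] at h
    rw [borelTransform_eq, ← (h.sigma fun n => hasSum_fintype _).tsum_eq]
    refine tsum_congr fun n => ?_
    rw [coeff_mk_mul_mk_mul_gammaKernel,
      ← Finset.sum_attach (Finset.HasAntidiagonal.antidiagonal n), Finset.univ_eq_attach]
    simp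

end Convolution

theorem integral_exp_mul_gammaKernel {p s : ℝ} (hp : 0 < p) (hs : 0 < s) :
    ∫ x in Set.Ioi 0, Real.exp (-s * x) * gammaKernel p x = s ^ (-p) := by
  have hΓ := Real.Gamma_pos_of_pos hp
  calc _ = ∫ x in Set.Ioi 0, x ^ (p - 1) * Real.exp (-(s * x)) * (Real.Gamma p)⁻¹ := by
        congr with x
        rw [gammaKernel, neg_mul]
        ring
    _ = _ := by
        rw [integral_mul_const, Real.integral_rpow_mul_exp_neg_mul_Ioi hp hs, one_div,
          Real.inv_rpow hs.le, Real.rpow_neg hs.le]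
        field_simp

theorem integrableOn_exp_mul_gammaKernel {p s : ℝ} (hp : 0 < p) (hs : 0 < s) :
    IntegrableOn (fun x => Real.exp (-s * x) * gammaKernel p x) (Set.Ioi 0) := by
  refine Integrable.of_integral_ne_zero ?_
  rw [integral_exp_mul_gammaKernel hp hs]
  positivity

theorem laplace_ofReal (f : ℝ → ℝ) (s : ℝ) :
    laplace f s = ((∫ x in Set.Ioi 0, Real.exp (-s * x) * f x : ℝ) : ℂ) := by
  rw [laplace, ← integral_complex_ofReal]
  push_cast
  rfl

theorem laplaceTerm_ofReal (β θ : ℝ) (η : ℕ → ℝ) {s : ℝ} (hs : 0 < s) (i : ℕ) :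
    laplaceTerm β θ η s i = ((η i * s ^ (-(i * θ + β)) : ℝ) : ℂ) := by
  rw [laplaceTerm]
  push_cast [Complex.ofReal_cpow hs.le]
  ring_nf

/-- The common real-variable content of the two senses of `HasLaplaceForm`. -/
def HasRealBorelForm (f : ℝ → ℝ) (Ψ β θ : ℝ) (η : ℕ → ℝ) : Prop :=
  BorelSummable β θ η ∧ ∃ σ : ℝ, 0 < σ ∧ ∀ s : ℝ, σ < s →
    IntegrableOn (fun x => Real.exp (-s * x) * borelTransform β θ η x) (Set.Ioi 0) ∧
    ∫ x in Set.Ioi 0, Real.exp (-s * x) * f x =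
      Ψ * ∫ x in Set.Ioi 0, Real.exp (-s * x) * borelTransform β θ η x

section RealForm

variable {f : ℝ → ℝ} {Ψ β θ : ℝ} {η : ℕ → ℝ}

theorem HasBorelForm.hasRealBorelForm (hβ : 0 < β) (hθ : 0 < θ) (h : HasBorelForm f Ψ β θ η) :
    HasRealBorelForm f Ψ β θ η := by
  obtain ⟨hgrowth, σ, hσ, hs⟩ := h
  refine ⟨hgrowth.borelSummable hβ hθ, σ, hσ, fun s hσs => ?_⟩
  obtain ⟨hint, heq⟩ := hs s (by simpa using hσs)
  constructor
  · refine hint.re.congr (ae_of_all _ fun x => ?_)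
    beta_reduce
    rw [show (-(s : ℂ) * (x : ℂ)) = ((-s * x : ℝ) : ℂ) by push_cast; ring, ← Complex.ofReal_exp,
      ← Complex.ofReal_mul]
    simp only [RCLike.re_to_complex, Complex.ofReal_re]
  · rw [laplace_ofReal, laplace_ofReal] at heq
    exact_mod_cast heq

theorem HasConvergentForm.hasRealBorelForm (hβ : 0 < β) (hθ : 0 < θ)
    (h : HasConvergentForm f Ψ β θ η) : HasRealBorelForm f Ψ β θ η := by
  obtain ⟨σ, hσ, hs⟩ := h
  have hsum : ∀ s : ℝ, σ < s → Summable fun i : ℕ => |η i| * s ^ (-(i * θ + β)) := by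
    intro s hσs
    have hs0 : 0 < s := hσ.trans hσs
    refine (hs s (by simpa using hσs)).1.congr fun i => ?_
    rw [laplaceTerm_ofReal β θ η hs0, Complex.norm_real, norm_mul, Real.norm_eq_abs,
      Real.norm_of_nonneg (by positivity)]
  have hBorel : BorelSummable β θ η := by
    have h1 := hsum (σ + 1) (by linarith)
    have hσ1 : 0 < σ + 1 := by linarith
    refine (growthCondition_of_le_geometric (R := (σ + 1) ^ θ)
      (C := (∑' i : ℕ, |η i| * (σ + 1) ^ (-(i * θ + β))) * (σ + 1) ^ β) hθ
      (by positivity) fun i => ?_).borelSummable hβ hθ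
    have hle := h1.le_tsum i fun j _ => by positivity
    calc |η i| = |η i| * (σ + 1) ^ (-(i * θ + β)) * ((σ + 1) ^ β * ((σ + 1) ^ θ) ^ i) := by
          rw [← Real.rpow_natCast, ← Real.rpow_mul hσ1.le, ← Real.rpow_add hσ1, mul_assoc,
            ← Real.rpow_add hσ1]
          ring_nf
          simp
      _ ≤ _ := by
          rw [mul_assoc _ ((σ + 1) ^ β)]
          gcongr
  refine ⟨hBorel, σ, hσ, fun s hσs => ?_⟩
  have hs0 : 0 < s := hσ.trans hσs
  set F : ℕ → ℝ → ℝ := fun i x =>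
    η i * (Real.exp (-s * x) * gammaKernel (i * θ + β) x) with hF
  have hFint : ∀ i, IntegrableOn (F i) (Set.Ioi 0) := fun i =>
    (integrableOn_exp_mul_gammaKernel (by positivity) hs0).const_mul _
  have hFval : ∀ i, ∫ x in Set.Ioi 0, F i x = η i * s ^ (-(i * θ + β)) := by
    intro i
    rw [integral_const_mul, integral_exp_mul_gammaKernel (by positivity) hs0]
  have hFnorm : ∀ i, ∫ x in Set.Ioi 0, ‖F i x‖ = |η i| * s ^ (-(i * θ + β)) := by
    intro i
    rw [← integral_exp_mul_gammaKernel (by positivity) hs0, ← integral_const_mul]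
    refine setIntegral_congr_fun measurableSet_Ioi fun x hx => ?_
    simp only [hF]
    rw [norm_mul, Real.norm_eq_abs, Real.norm_of_nonneg (mul_nonneg (Real.exp_pos _).le
      (gammaKernel_nonneg (by positivity) (le_of_lt hx)))]
  have hFsum : Summable fun i => ∫ x in Set.Ioi 0, ‖F i x‖ := by
    simpa only [hFnorm] using hsum s hσs
  have hFtsum : ∀ x, ∑' i, F i x = Real.exp (-s * x) * borelTransform β θ η x := by
    intro x
    rw [borelTransform_eq, ← tsum_mul_left]
    exact tsum_congr fun i => by simp only [hF]; ring
  constructor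
  · simp only [← hFtsum]
    refine integrable_tsum_of_summable_integral_norm hFint hFsum ?_
    filter_upwards [ae_restrict_mem measurableSet_Ioi] with x hx
    refine ((borelSummable_iff.1 hBorel x hx).mul_left (Real.exp (-s * x))).congr fun i => ?_
    simp only [hF]
    rw [norm_mul, norm_mul, norm_mul, Real.norm_of_nonneg (Real.exp_pos _).le]
    ring
  · have hval := (hasSum_integral_of_summable_integral_norm hFint hFsum).tsum_eq
    simp only [hFval, hFtsum] at hval
    have h2 := (hs s (by simpa using hσs)).2
    simp only [laplace_ofReal, laplaceTerm_ofReal β θ η hs0] at h2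
    rw [← Complex.ofReal_tsum, hval] at h2
    exact_mod_cast h2

theorem HasLaplaceForm.hasRealBorelForm (hβ : 0 < β) (hθ : 0 < θ)
    (h : HasLaplaceForm f Ψ β θ η) : HasRealBorelForm f Ψ β θ η :=
  h.elim (·.hasRealBorelForm hβ hθ) (·.hasRealBorelForm hβ hθ)

theorem HasRealBorelForm.ae_eq (h : HasRealBorelForm f Ψ β θ η)
    (hf : IntegrableOn f (Set.Ioi 0)) :
    f =ᵐ[volume.restrict (Set.Ioi 0)] fun x => Ψ * borelTransform β θ η x := by
  obtain ⟨-, σ, hσ, hs⟩ := h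
  have hfs : ∀ s, σ < s → IntegrableOn (fun x => Real.exp (-s * x) * f x) (Set.Ioi 0) := by
    intro s hσs
    refine hf.bdd_mul (c := 1) (by fun_prop) ?_
    filter_upwards [ae_restrict_mem measurableSet_Ioi] with x hx
    have hx : 0 < x := hx
    rw [Real.norm_of_nonneg (Real.exp_pos _).le, Real.exp_le_one_iff]
    nlinarith
  have hB : ∀ s, σ < s → IntegrableOn
      (fun x => Ψ * (Real.exp (-s * x) * borelTransform β θ η x)) (Set.Ioi 0) :=
    fun s hσs => (hs s hσs).1.const_mul Ψ
  have heq : ∀ s x : ℝ, Real.exp (-s * x) * (f x - Ψ * borelTransform β θ η x) =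
      Real.exp (-s * x) * f x - Ψ * (Real.exp (-s * x) * borelTransform β θ η x) :=
    fun s x => by ring
  have h0 := ae_eq_zero_of_laplace_eq_zero (h := fun x => f x - Ψ * borelTransform β θ η x)
    (σ := σ) (fun s hσs => by
      simp only [heq]
      exact (hfs s hσs).sub (hB s hσs))
    (fun s hσs => by
      simp only [heq]
      rw [integral_sub (hfs s hσs) (hB s hσs), integral_const_mul, (hs s hσs).2, sub_self])
  filter_upwards [h0] with x hx
  simpa [sub_eq_zero] using hx

end RealForm

/-- The convolution of two measures on `(0, ∞)` with densities `f` and `g`. -/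
theorem withDensity_conv_withDensity_Ioi {f g h : ℝ → ℝ}
    (hf : ContinuousOn f (Set.Ioi 0)) (hg : ContinuousOn g (Set.Ioi 0))
    (hf0 : ∀ x, 0 < x → 0 ≤ f x) (hg0 : ∀ x, 0 < x → 0 ≤ g x)
    (hint : ∀ x, 0 < x → IntegrableOn (fun y => f y * g (x - y)) (Set.Ioo 0 x))
    (hval : ∀ x, 0 < x → ∫ y in Set.Ioo 0 x, f y * g (x - y) = h x) :
    (volume.restrict (Set.Ioi 0)).withDensity (fun x => ENNReal.ofReal (f x)) ∗
        (volume.restrict (Set.Ioi 0)).withDensity (fun x => ENNReal.ofReal (g x)) =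
      (volume.restrict (Set.Ioi 0)).withDensity (fun x => ENNReal.ofReal (h x)) := by
  have hmeas : ∀ {k : ℝ → ℝ}, ContinuousOn k (Set.Ioi 0) →
      AEMeasurable ((Set.Ioi 0).indicator fun x => ENNReal.ofReal (k x)) volume := fun hk =>
    (aemeasurable_indicator_iff measurableSet_Ioi).2
      (hk.aemeasurable measurableSet_Ioi).ennreal_ofReal
  simp only [← withDensity_indicator measurableSet_Ioi]
  rw [conv_withDensity_eq_mlconvolution₀ (hmeas hf) (hmeas hg)]
  congr 1
  ext x
  have hind : ∀ y, (Set.Ioi 0).indicator (fun x => ENNReal.ofReal (f x)) y *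
      (Set.Ioi 0).indicator (fun x => ENNReal.ofReal (g x)) (-y + x) =
      (Set.Ioo 0 x).indicator (fun y => ENNReal.ofReal (f y * g (x - y))) y := by
    intro y
    rw [neg_add_eq_sub]
    by_cases h1 : 0 < y
    · by_cases h2 : y < x
      · rw [Set.indicator_of_mem (Set.mem_Ioi.2 h1), Set.indicator_of_mem
          (Set.mem_Ioi.2 (sub_pos.2 h2)), Set.indicator_of_mem (Set.mem_Ioo.2 ⟨h1, h2⟩),
          ENNReal.ofReal_mul (hf0 y h1)]
      · simp [h2]
    · simp [h1]
  rw [lconvolution_def]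
  simp only [hind]
  rw [lintegral_indicator measurableSet_Ioo]
  by_cases hx : 0 < x
  · rw [Set.indicator_of_mem (Set.mem_Ioi.2 hx), ← hval x hx,
      ofReal_integral_eq_lintegral_ofReal (hint x hx)]
    filter_upwards [ae_restrict_mem measurableSet_Ioo] with y hy
    exact mul_nonneg (hf0 y hy.1) (hg0 _ (sub_pos.2 hy.2))
  · simp [hx]

section Law

variable {Ω : Type*} [MeasurableSpace Ω] {P : Measure Ω} [IsProbabilityMeasure P]
  {Ψ β θ : ℝ} {η : ℕ → ℝ}

/-- The law of a nonnegative variable is determined by the form of its Laplace transform. -/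
theorem HasRealBorelForm.map_eq (hβ : 0 < β) (hθ : 0 < θ) {X : Ω → ℝ} [HasPDF X P volume]
    (hX : ∀ᵐ ω ∂P, 0 ≤ X ω) (h : HasRealBorelForm (density P X) Ψ β θ η) :
    (∀ x, 0 < x → 0 ≤ Ψ * borelTransform β θ η x) ∧
      P.map X = (volume.restrict (Set.Ioi 0)).withDensity
        fun x => ENNReal.ofReal (Ψ * borelTransform β θ η x) := by
  have hXm : AEMeasurable X P := HasPDF.aemeasurable X P volume
  have hdens : Integrable (density P X) := by
    refine integrable_toReal_of_lintegral_ne_top (measurable_pdf X P volume).aemeasurable ?_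
    rw [pdf.lintegral_eq_measure_univ]
    exact measure_ne_top _ _
  have hae := h.ae_eq hdens.integrableOn
  have hcont : ContinuousOn (fun x => Ψ * borelTransform β θ η x) (Set.Ioi 0) :=
    (continuousOn_borelTransform hβ hθ h.1).const_mul Ψ |>.congr fun x _ => rfl
  constructor
  · have hmax : (fun x => Ψ * borelTransform β θ η x) =ᵐ[volume.restrict (Set.Ioi 0)]
        fun x => max (Ψ * borelTransform β θ η x) 0 := by
      filter_upwards [hae] with x hx
      rw [← hx, max_eq_left]
      exact ENNReal.toReal_nonneg
    have heq := Measure.eqOn_of_ae_eq hmax hcont (hcont.sup continuousOn_const)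
      (by rw [isOpen_Ioi.interior_eq]; exact subset_closure)
    intro x hx
    have hx' : Ψ * borelTransform β θ η x = max (Ψ * borelTransform β θ η x) 0 := heq hx
    rw [hx']
    exact le_max_right _ _
  · have hpos : ∀ᵐ x ∂(P.map X), x ∈ Set.Ioi (0 : ℝ) := by
      have h1 : ∀ᵐ x ∂(P.map X), 0 ≤ x := (ae_map_iff hXm measurableSet_Ici).2 hX
      have h2 : ∀ᵐ x ∂(P.map X), x ≠ 0 :=
        (HasPDF.absolutelyContinuous : P.map X ≪ volume).ae_le
          (Measure.ae_ne volume 0)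
      filter_upwards [h1, h2] with x hx1 hx2 using lt_of_le_of_ne hx1 hx2.symm
    rw [← Measure.restrict_eq_self_of_ae_mem hpos, map_eq_withDensity_pdf X P volume,
      restrict_withDensity measurableSet_Ioi]
    refine withDensity_congr_ae ?_
    have hfin : ∀ᵐ x : ℝ, pdf X P volume x < ⊤ := pdf.ae_lt_top
    filter_upwards [hae, ae_restrict_of_ae hfin] with x hx hlt
    rw [← hx, density, ENNReal.ofReal_toReal hlt.ne]

/-- The law of a sum of independent variables with the same Borel-type density. -/
theorem map_sum_eq {ι : Type*} {X : ι → Ω → ℝ} (hindep : iIndepFun X P)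
    (hXm : ∀ l, AEMeasurable (X l) P) (hβ : 0 < β) (hθ : 0 < θ) (hη : BorelSummable β θ η)
    (hnonneg : ∀ x, 0 < x → 0 ≤ Ψ * borelTransform β θ η x)
    (hlaw : ∀ l, P.map (X l) = (volume.restrict (Set.Ioi 0)).withDensity
      fun x => ENNReal.ofReal (Ψ * borelTransform β θ η x)) {s : Finset ι} (hs : s.Nonempty) :
    BorelSummable (s.card * β) θ (fun n => PowerSeries.coeff n (PowerSeries.mk η ^ s.card)) ∧
    (∀ x, 0 < x → 0 ≤ Ψ ^ s.card * borelTransform (s.card * β) θ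
      (fun n => PowerSeries.coeff n (PowerSeries.mk η ^ s.card)) x) ∧
    P.map (∑ l ∈ s, X l) = (volume.restrict (Set.Ioi 0)).withDensity
      fun x => ENNReal.ofReal (Ψ ^ s.card * borelTransform (s.card * β) θ
        (fun n => PowerSeries.coeff n (PowerSeries.mk η ^ s.card)) x) := by
  induction hs using Finset.Nonempty.cons_induction with
  | singleton l => simpa using ⟨hη, hnonneg, hlaw l⟩
  | cons l s hl hs ih =>
    obtain ⟨ih1, ih2, ih3⟩ := ih
    have hcard : 0 < (s.card : ℝ) * β := by
      have : 0 < s.card := hs.card_pos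
      positivity
    have hpow : (fun n => PowerSeries.coeff n (PowerSeries.mk η ^ (s.card + 1))) =
        fun n => PowerSeries.coeff n (PowerSeries.mk
          (fun n => PowerSeries.coeff n (PowerSeries.mk η ^ s.card)) * PowerSeries.mk η) := by
      rw [show PowerSeries.mk (fun n => PowerSeries.coeff n (PowerSeries.mk η ^ s.card)) =
        PowerSeries.mk η ^ s.card from PowerSeries.ext fun n => PowerSeries.coeff_mk _ _, pow_succ]
    have hconv := fun x hx =>
      integral_borelTransform_mul_borelTransform hcard hβ hθ ih1 hη (x := x) hx
    rw [Finset.card_cons, Nat.cast_add_one, add_one_mul, hpow]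
    have hmul : ∀ x y, Ψ ^ s.card * borelTransform (s.card * β) θ
        (fun n => PowerSeries.coeff n (PowerSeries.mk η ^ s.card)) y *
        (Ψ * borelTransform β θ η (x - y)) = Ψ ^ (s.card + 1) * (borelTransform (s.card * β) θ
        (fun n => PowerSeries.coeff n (PowerSeries.mk η ^ s.card)) y *
          borelTransform β θ η (x - y)) := fun x y => by ring
    have hval : ∀ x, 0 < x → ∫ y in Set.Ioo 0 x, Ψ ^ s.card * borelTransform (s.card * β) θ
        (fun n => PowerSeries.coeff n (PowerSeries.mk η ^ s.card)) y *
        (Ψ * borelTransform β θ η (x - y)) = Ψ ^ (s.card + 1) * borelTransform (s.card * β + β) θ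
          (fun n => PowerSeries.coeff n (PowerSeries.mk
          (fun n => PowerSeries.coeff n (PowerSeries.mk η ^ s.card)) * PowerSeries.mk η)) x := by
      intro x hx
      simp only [hmul]
      rw [integral_const_mul, (hconv x hx).2]
    refine ⟨ih1.mul hcard hβ hθ hη, fun x hx => ?_, ?_⟩
    · rw [← hval x hx]
      exact setIntegral_nonneg measurableSet_Ioo fun y hy =>
        mul_nonneg (ih2 y hy.1) (hnonneg _ (sub_pos.2 hy.2))
    · rw [Finset.sum_cons, add_comm, (hindep.indepFun_finsetSum_of_notMem₀ hXm hl
        ).map_add_eq_map_conv_map₀ (Finset.aemeasurable_sum _ fun i _ => hXm i) (hXm l),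
        ih3, hlaw l]
      refine withDensity_conv_withDensity_Ioi
        ((continuousOn_borelTransform hcard hθ ih1).const_mul _ |>.congr fun x _ => rfl)
        ((continuousOn_borelTransform hβ hθ hη).const_mul _ |>.congr fun x _ => rfl)
        ih2 hnonneg (fun x hx => ?_) hval
      simp only [hmul]
      exact (hconv x hx).1.const_mul _

theorem borelTransform_pi_single (θ : ℝ) (x : ℝ) : borelTransform 1 θ (Pi.single 0 1) x = 1 := by
  rw [borelTransform_eq, tsum_eq_single 0 fun i hi => by simp [hi]]
  simp [gammaKernel]

theorem borelSummable_pi_single (θ : ℝ) : BorelSummable 1 θ (Pi.single 0 1) := by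
  rw [borelSummable_iff]
  intro x _
  exact summable_of_ne_finset_zero (s := {0}) fun i hi => by
    simp [show i ≠ 0 by simpa using hi]

/-- Integrating a Borel transform raises its exponent by one. -/
theorem integral_borelTransform {α : ℝ} {a : ℕ → ℝ} (hα : 0 < α) (hθ : 0 < θ)
    (ha : BorelSummable α θ a) {x : ℝ} (hx : 0 < x) :
    BorelSummable (α + 1) θ a ∧ IntegrableOn (borelTransform α θ a) (Set.Ioo 0 x) ∧
      ∫ y in Set.Ioo 0 x, borelTransform α θ a y = borelTransform (α + 1) θ a x := by
  have hone : PowerSeries.mk (Pi.single 0 1 : ℕ → ℝ) = 1 := by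
    ext n
    rw [PowerSeries.coeff_mk, PowerSeries.coeff_one, Pi.single_apply]
  have h1 := ha.mul hα one_pos hθ (borelSummable_pi_single θ)
  have h2 := integral_borelTransform_mul_borelTransform hα one_pos hθ ha
    (borelSummable_pi_single θ) hx
  simp only [hone, mul_one, PowerSeries.coeff_mk, borelTransform_pi_single] at h1 h2
  exact ⟨h1, h2⟩

end Law

end LaplaceSum

theorem corollary1 {Ω : Type*} [MeasurableSpace Ω] (P : Measure Ω) [IsProbabilityMeasure P]
    (L : ℕ) (hL : 1 ≤ L) (X : Fin L → Ω → ℝ)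
    (hindep : iIndepFun X P)
    (hpdf : ∀ l, HasPDF (X l) P volume)
    (hnonneg : ∀ l, ∀ᵐ ω ∂P, 0 ≤ X l ω)
    (Ψ β θ : ℝ) (hΨ : 0 < Ψ) (hβ : 0 < β) (hθ : 0 < θ)
    (η : ℕ → ℝ) (hη : η 0 ≠ 0)
    (hform : ∀ l, LaplaceSum.HasLaplaceForm (LaplaceSum.density P (X l)) Ψ β θ η) :
    -- the probability density function of the sum
    (∀ x : ℝ, 0 < x → Summable fun i : ℕ =>
      |LaplaceSum.delta η L i * x ^ (-1 + θ * (i : ℝ) + (L : ℝ) * β) /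
        Real.Gamma ((i : ℝ) * θ + (L : ℝ) * β)|) ∧
    (∀ x : ℝ, 0 < x → 0 ≤ Ψ ^ L * ∑' i : ℕ,
      LaplaceSum.delta η L i * x ^ (-1 + θ * (i : ℝ) + (L : ℝ) * β) /
        Real.Gamma ((i : ℝ) * θ + (L : ℝ) * β)) ∧
    HasPDF (fun ω => ∑ l, X l ω) P volume ∧
    P.map (fun ω => ∑ l, X l ω) = (volume.restrict (Set.Ioi 0)).withDensity (fun x : ℝ =>
      ENNReal.ofReal (Ψ ^ L * ∑' i : ℕ,
        LaplaceSum.delta η L i * x ^ (-1 + θ * (i : ℝ) + (L : ℝ) * β) /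
          Real.Gamma ((i : ℝ) * θ + (L : ℝ) * β))) ∧
    -- the cumulative distribution function of the sum
    (∀ x : ℝ, 0 ≤ x → Summable fun i : ℕ =>
      |LaplaceSum.delta η L i * x ^ (θ * (i : ℝ) + (L : ℝ) * β) /
        Real.Gamma (1 + (i : ℝ) * θ + (L : ℝ) * β)|) ∧
    (∀ x : ℝ, 0 ≤ x → P.real {ω | ∑ l, X l ω ≤ x} = Ψ ^ L * ∑' i : ℕ,
      LaplaceSum.delta η L i * x ^ (θ * (i : ℝ) + (L : ℝ) * β) /
        Real.Gamma (1 + (i : ℝ) * θ + (L : ℝ) * β)) ∧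
    -- the coefficients are those of the `L`-th power of the power series `∑ η_i z^i`
    PowerSeries.mk (LaplaceSum.delta η L) = PowerSeries.mk η ^ L := by
  have hXm : ∀ l, AEMeasurable (X l) P := fun l => HasPDF.aemeasurable (X l) P volume
  have hreal := fun l => (hform l).hasRealBorelForm hβ hθ
  have hlaw := fun l => (hreal l).map_eq hβ hθ (hnonneg l)
  have hne : (Finset.univ : Finset (Fin L)).Nonempty := ⟨⟨0, hL⟩, Finset.mem_univ _⟩
  have hδ := LaplaceSum.mk_delta η hη L
  have hcoeff : (fun n => PowerSeries.coeff n (PowerSeries.mk η ^ L)) = LaplaceSum.delta η L := by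
    rw [← hδ]
    exact funext fun n => PowerSeries.coeff_mk _ _
  have hLβ : 0 < (L : ℝ) * β := by
    have : 0 < L := hL
    positivity
  obtain ⟨hsum, hpos, hmap⟩ := LaplaceSum.map_sum_eq hindep hXm hβ hθ (hreal ⟨0, hL⟩).1
    (hlaw ⟨0, hL⟩).1 (fun l => (hlaw l).2) hne
  rw [Finset.card_univ, Fintype.card_fin, hcoeff] at hsum hpos hmap
  rw [show ∑ l, X l = fun ω => ∑ l, X l ω from funext fun ω => Finset.sum_apply _ _ _] at hmap
  have hSm : AEMeasurable (fun ω => ∑ l, X l ω) P := by fun_prop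
  have hcont := LaplaceSum.continuousOn_borelTransform hLβ hθ hsum
  have hterm : ∀ (x : ℝ) (i : ℕ), LaplaceSum.delta η L i * x ^ (θ * (i : ℝ) + (L : ℝ) * β) /
        Real.Gamma (1 + (i : ℝ) * θ + (L : ℝ) * β) =
      LaplaceSum.delta η L i * x ^ (-1 + θ * (i : ℝ) + ((L : ℝ) * β + 1)) /
        Real.Gamma ((i : ℝ) * θ + ((L : ℝ) * β + 1)) := by
    intro x i
    rw [show -1 + θ * (i : ℝ) + ((L : ℝ) * β + 1) = θ * (i : ℝ) + (L : ℝ) * β by ring,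
      show (i : ℝ) * θ + ((L : ℝ) * β + 1) = 1 + (i : ℝ) * θ + (L : ℝ) * β by ring]
  have hzero : ∀ i : ℕ, LaplaceSum.delta η L i * (0 : ℝ) ^ (θ * (i : ℝ) + (L : ℝ) * β) /
      Real.Gamma (1 + (i : ℝ) * θ + (L : ℝ) * β) = 0 := by
    intro i
    rw [Real.zero_rpow (by positivity), mul_zero, zero_div]
  refine ⟨hsum, hpos, ?_, hmap, fun x hx => ?_, fun x hx => ?_, hδ⟩
  · refine hasPDF_of_map_eq_withDensity hSm ((Set.Ioi 0).indicator fun x => ENNReal.ofReal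
      (Ψ ^ L * LaplaceSum.borelTransform (L * β) θ (LaplaceSum.delta η L) x)) ?_ ?_
    · exact (aemeasurable_indicator_iff measurableSet_Ioi).2
        ((hcont.aemeasurable measurableSet_Ioi).const_mul _).ennreal_ofReal
    · rw [withDensity_indicator measurableSet_Ioi, hmap]
  · rcases hx.eq_or_lt with rfl | hx
    · simp only [hzero, abs_zero, summable_zero]
    · simp only [hterm]
      exact (LaplaceSum.integral_borelTransform hLβ hθ hsum hx).1 x hx
  · have hset : P {ω | ∑ l, X l ω ≤ x} = P.map (fun ω => ∑ l, X l ω) (Set.Iic x) :=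
      (Measure.map_apply_of_aemeasurable hSm measurableSet_Iic).symm
    rw [measureReal_def, hset, hmap, withDensity_apply _ measurableSet_Iic,
      Measure.restrict_restrict measurableSet_Iic, Set.inter_comm, Set.Ioi_inter_Iic,
      ← restrict_Ioo_eq_restrict_Ioc]
    rcases hx.eq_or_lt with rfl | hx
    · simp [hzero]
    · obtain ⟨-, hint, hval⟩ := LaplaceSum.integral_borelTransform hLβ hθ hsum hx
      simp only [hterm]
      refine Eq.trans ?_ (congrArg (Ψ ^ L * ·) hval)
      have hnn : 0 ≤ᵐ[volume.restrict (Set.Ioo 0 x)] fun y =>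
          Ψ ^ L * LaplaceSum.borelTransform (L * β) θ (LaplaceSum.delta η L) y := by
        filter_upwards [ae_restrict_mem measurableSet_Ioo] with y hy using hpos y hy.1
      rw [← integral_const_mul, integral_eq_lintegral_of_nonneg_ae hnn (hint.const_mul _).1]
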